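/- Let $\Bbbk$ be an algebraically closed field and $A$ a finite-dimensional unital associative $\Bbbk$-algebra which is basic (all simple $A$-modules are one-dimensional over $\Bbbk$), and let $A\text{-mod}$ be the category of finitely generated (equivalently, finite-dimensional) left $A$-modules. Let $L_1,\dots,L_n$ be a complete list of pairwise non-isomorphic simple $A$-modules and let $P_i$ be the projective cover of $L_i$. Let $S\subsetneq\{1,\dots,n\}$ be a proper subset, $S'=\{1,\dots,n\}\setminus S$, and $P_{S'}=\bigoplus_{i\in S'}P_i$. Let $\mathcal N_S$ be the Serre subcategory of $A\text{-mod}$ consisting of all modules $N$ such that every composition factor of $N$ isomorphic to some $L_i$ has $i\in S$. Let $\mathcal Q_S=A\text{-mod}/\mathcal N_S$ be the Serre quotient, i.e. the localization of $A\text{-mod}$ at all homomorphisms whose kernel and cokernel lie in $\mathcal N_S$. Let $\mathrm{add}(P_{S'})$ be the class of modules isomorphic to finite direct sums of direct summands of $P_{S'}$, let $\mathcal X_{P_{S'}}$ be the full subcategory of $A\text{-mod}$ of all modules $Y$ which admit an exact sequence $X_1\to X_0\to Y\to 0$ with $X_0,X_1\in\mathrm{add}(P_{S'})$, and let $B_{S'}=\mathrm{End}_A(P_{S'})^{\mathrm{op}}$,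 with $B_{S'}\text{-mod}$ the category of finitely generated left $B_{S'}$-modules. Then there are $\Bbbk$-linear equivalences of categories $$\mathcal Q_S\;\cong\;\mathcal X_{P_{S'}}\;\cong\;B_{S'}\text{-mod}.$$ More precisely, the composition $\mathcal X_{P_{S'}}\hookrightarrow A\text{-mod}\to\mathcal Q_S$ of the inclusion with the canonical quotient functor is quasi-inverse to the first equivalence, and the second equivalence is isomorphic to the functor $\mathrm{Hom}_A(P_{S'},-)$. -/

import Mathlib

open CategoryTheory

universe w u

namespace SerreQuot

section Basic

/-- A `k`-algebra `A` is basic if all simple `A`-modules are one-dimensional over `k`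
(the definition for `k` algebraically closed and `A` finite dimensional). -/
def IsBasicAlgebra (k : Type w) (A : Type u) [Field k] [Ring A] [Algebra k A] : Prop :=
  ∀ (M : Type u) [AddCommGroup M] [Module k M] [Module A M] [IsScalarTower k A M],
    IsSimpleModule A M → Module.finrank k M = 1

/-- `π : P → L` is a projective cover: `P` is projective and `π` is surjective with superfluous
kernel. -/
structure IsProjectiveCover {A : Type u} [Ring A] {P L : Type u} [AddCommGroup P] [Module A P]
    [AddCommGroup L] [Module A L] (π : P →ₗ[A] L) : Prop where
  projective : Module.Projective A P
  surjective : Function.Surjective π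
  superfluous : ∀ U : Submodule A P, U ⊔ LinearMap.ker π = ⊤ → U = ⊤

end Basic

section CompositionFactors

variable {A : Type u} [Ring A]

/-- `[N : L] ≠ 0`: some composition series `0 = N₀ ⊂ N₁ ⊂ ⋯ ⊂ N_m = N` has a factor
`N_{j+1} / N_j` isomorphic to `L`. -/
def IsCompositionFactor (L N : Type u) [AddCommGroup L] [Module A L]
    [AddCommGroup N] [Module A N] : Prop :=
  ∃ s : CompositionSeries (Submodule A N), s.head = ⊥ ∧ s.last = ⊤ ∧
    ∃ j : Fin s.length,
      Nonempty ((s j.succ ⧸ (s j.castSucc).submoduleOf (s j.succ)) ≃ₗ[A] L)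

theorem exists_series_of_le {N : Type u} [AddCommGroup N] [Module A N] [IsNoetherian A N]
    [IsArtinian A N] {U V : Submodule A N} (h : U ≤ V) :
    ∃ s : CompositionSeries (Submodule A N), s.head = U ∧ s.last = V := by
  obtain ⟨f, f0, n, fn, hn⟩ := exists_covBy_seq_of_wellFoundedLT_wellFoundedGT_of_le h
  exact ⟨⟨n, fun i ↦ f i, fun i ↦ hn i i.2⟩, f0, fn⟩

/-- For a module of finite length and a simple module `L`, being a composition factor is the same
as being a quotient of a submodule. -/
theorem isCompositionFactor_iff {L N : Type u} [AddCommGroup L] [Module A L]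
    [AddCommGroup N] [Module A N] [IsNoetherian A N] [IsArtinian A N] :
    IsCompositionFactor (A := A) L N ↔ IsSimpleModule A L ∧
      ∃ (U : Submodule A N) (g : U →ₗ[A] L), Function.Surjective g := by
  constructor
  · rintro ⟨s, -, -, j, ⟨e⟩⟩
    refine ⟨?_, s j.succ, e.toLinearMap ∘ₗ Submodule.mkQ _,
      e.surjective.comp (Submodule.mkQ_surjective _)⟩
    have cov : s j.castSucc ⋖ s j.succ := s.step j
    have : IsSimpleModule A (s j.succ ⧸ (s j.castSucc).submoduleOf (s j.succ)) :=
      (covBy_iff_quot_is_simple cov.le).mp cov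
    exact IsSimpleModule.congr e.symm
  · rintro ⟨hL, U, g, hg⟩
    let V : Submodule A N := (LinearMap.ker g).map U.subtype
    have hVU : V ≤ U := Submodule.map_subtype_le U _
    have hV : V.submoduleOf U = LinearMap.ker g :=
      Submodule.comap_map_eq_of_injective U.injective_subtype _
    have e : (U ⧸ V.submoduleOf U) ≃ₗ[A] L :=
      (Submodule.quotEquivOfEq _ _ hV).trans (g.quotKerEquivOfSurjective hg)
    have cov : V ⋖ U := (covBy_iff_quot_is_simple hVU).mpr (IsSimpleModule.congr e)
    obtain ⟨p, p0, p1⟩ := exists_series_of_le (bot_le : ⊥ ≤ V)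
    obtain ⟨q, q0, q1⟩ := exists_series_of_le (le_top : U ≤ ⊤)
    have cov' : p.last ⋖ q.head := by rwa [p1, q0]
    let j : Fin (p.append q cov').length := ⟨p.length, by simp [RelSeries.append]⟩
    have h0 : p.append q cov' j.castSucc = V := by
      rw [← p1]
      exact RelSeries.append_apply_left p q cov' (Fin.last _)
    have h1 : p.append q cov' j.succ = U := by
      rw [← q0]
      exact RelSeries.append_apply_right p q cov' 0
    refine ⟨p.append q cov', by simpa using p0, by simpa using q1, j, ?_⟩
    rw [h0, h1]
    exact ⟨e⟩

end CompositionFactors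

section SerreSubcategory

variable {A : Type u} [Ring A] {n : ℕ}

/-- The full subcategory `N_S` of `A`-mod: all modules `N` such that `[N : L i] ≠ 0` implies
`i ∈ S`. -/
def serreSubcategory (L : Fin n → FGModuleCat.{u} A) (S : Set (Fin n)) :
    ObjectProperty (FGModuleCat.{u} A) :=
  fun N => ∀ i, IsCompositionFactor (A := A) (L i) N → i ∈ S

theorem isCompositionFactor_of_injective [IsArtinianRing A] {L M N : FGModuleCat.{u} A}
    (f : M →ₗ[A] N) (hf : Function.Injective f) (h : IsCompositionFactor (A := A) L M) :
    IsCompositionFactor (A := A) L N := by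
  rw [isCompositionFactor_iff] at h ⊢
  obtain ⟨hL, U, g, hg⟩ := h
  exact ⟨hL, U.map f, g ∘ₗ (Submodule.equivMapOfInjective f hf U).symm.toLinearMap,
    hg.comp (Submodule.equivMapOfInjective f hf U).symm.surjective⟩

theorem isCompositionFactor_of_surjective [IsArtinianRing A] {L M N : FGModuleCat.{u} A}
    (f : M →ₗ[A] N) (hf : Function.Surjective f) (h : IsCompositionFactor (A := A) L N) :
    IsCompositionFactor (A := A) L M := by
  rw [isCompositionFactor_iff] at h ⊢
  obtain ⟨hL, U, g, hg⟩ := h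
  refine ⟨hL, U.comap f, g ∘ₗ f.restrict (fun x hx => hx), hg.comp ?_⟩
  rintro ⟨y, hy⟩
  obtain ⟨x, rfl⟩ := hf y
  exact ⟨⟨x, hy⟩, rfl⟩

theorem isCompositionFactor_of_exact [IsArtinianRing A] {L M₁ M₂ M₃ : FGModuleCat.{u} A}
    (f : M₁ →ₗ[A] M₂) (q : M₂ →ₗ[A] M₃) (hfq : Function.Exact f q)
    (h : IsCompositionFactor (A := A) L M₂) :
    IsCompositionFactor (A := A) L M₁ ∨ IsCompositionFactor (A := A) L M₃ := by
  simp only [isCompositionFactor_iff] at h ⊢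
  obtain ⟨hL, U, g, hg⟩ := h
  let g₁ : U.comap f →ₗ[A] L := g ∘ₗ f.restrict (fun x hx => hx)
  rcases g₁.surjective_or_eq_zero with h₁ | h₁
  · exact Or.inl ⟨hL, _, g₁, h₁⟩
  · right
    let q' : U →ₗ[A] M₃ := q ∘ₗ U.subtype
    have hker : LinearMap.ker q' ≤ LinearMap.ker g := by
      rintro ⟨x, hx⟩ hqx
      obtain ⟨y, rfl⟩ := (hfq x).mp hqx
      exact LinearMap.congr_fun h₁ ⟨y, hx⟩
    refine ⟨hL, LinearMap.range q',
      (LinearMap.ker q').liftQ g hker ∘ₗ q'.quotKerEquivRange.symm.toLinearMap, ?_⟩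
    intro l
    obtain ⟨x, rfl⟩ := hg l
    refine ⟨q'.quotKerEquivRange (Submodule.Quotient.mk x), ?_⟩
    simp

theorem injective_of_mono [IsArtinianRing A] {M N : FGModuleCat.{u} A} (f : M ⟶ N) [Mono f] :
    Function.Injective f.hom.hom :=
  (ModuleCat.mono_iff_injective _).mp
    (inferInstanceAs (Mono ((forget₂ (FGModuleCat.{u} A) (ModuleCat.{u} A)).map f)))

theorem surjective_of_epi [IsArtinianRing A] {M N : FGModuleCat.{u} A} (f : M ⟶ N) [Epi f] :
    Function.Surjective f.hom.hom :=
  (ModuleCat.epi_iff_surjective _).mp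
    (inferInstanceAs (Epi ((forget₂ (FGModuleCat.{u} A) (ModuleCat.{u} A)).map f)))

instance [IsArtinianRing A] (L : Fin n → FGModuleCat.{u} A) (S : Set (Fin n)) :
    (serreSubcategory L S).IsSerreClass where
  exists_zero := by
    refine ⟨FGModuleCat.of A PUnit, ?_, fun i h => ?_⟩
    · rw [Limits.IsZero.iff_id_eq_zero]
      ext
    · rw [isCompositionFactor_iff] at h
      obtain ⟨hL, U, g, hg⟩ := h
      have : Subsingleton (FGModuleCat.of A PUnit.{u + 1}) := inferInstanceAs (Subsingleton PUnit)
      exact absurd hg.subsingleton (not_subsingleton_iff_nontrivial.mpr hL.nontrivial)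
  prop_of_mono f _ hY i h :=
    hY i (isCompositionFactor_of_injective f.hom.hom (injective_of_mono f) h)
  prop_of_epi f _ hX i h :=
    hX i (isCompositionFactor_of_surjective f.hom.hom (surjective_of_epi f) h)
  prop_X₂_of_shortExact {T} hT h₁ h₃ i h := by
    have hE := hT.exact.map (forget₂ (FGModuleCat.{u} A) (ModuleCat.{u} A))
    have hE' := (ShortComplex.ShortExact.moduleCat_exact_iff_function_exact _).mp hE
    exact (isCompositionFactor_of_exact T.f.hom.hom T.g.hom.hom hE' h).elim (h₁ i) (h₃ i)

/-- The Serre quotient `A`-mod `/ N_S`: the localization of `A`-mod at all homomorphisms with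
kernel and cokernel in `N_S`. -/
abbrev SerreQuotient [IsArtinianRing A] (L : Fin n → FGModuleCat.{u} A) (S : Set (Fin n)) :=
  (serreSubcategory L S).isoModSerre.Localization

/-- The canonical functor `A`-mod `⥤` `A`-mod `/ N_S`. -/
noncomputable abbrev quotientFunctor [IsArtinianRing A] (L : Fin n → FGModuleCat.{u} A)
    (S : Set (Fin n)) : FGModuleCat.{u} A ⥤ SerreQuotient L S :=
  (serreSubcategory L S).isoModSerre.Q

end SerreSubcategory

section Presentations

variable {A : Type u} [Ring A]

/-- `add(X)`: modules isomorphic to a finite direct sum of direct summands of `X`. -/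
def addClosure (X : FGModuleCat.{u} A) : ObjectProperty (FGModuleCat.{u} A) :=
  fun Y => ∃ (m : ℕ) (Z : Fin m → FGModuleCat.{u} A),
    (∀ j, ∃ W : FGModuleCat.{u} A, Nonempty (X ≃ₗ[A] Z j × W)) ∧
    Nonempty (Y ≃ₗ[A] (∀ j, Z j))

/-- Modules `Y` with an exact sequence `X₁ → X₀ → Y → 0`, where `X₀` and `X₁` are in `add(X)`. -/
def presentedBy (X : FGModuleCat.{u} A) : ObjectProperty (FGModuleCat.{u} A) :=
  fun Y => ∃ (X₁ X₀ : FGModuleCat.{u} A) (f : X₁ →ₗ[A] X₀) (g : X₀ →ₗ[A] Y),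
    addClosure X X₁ ∧ addClosure X X₀ ∧ Function.Exact f g ∧ Function.Surjective g

/-- `P_T = ⨁_{i ∈ T} P_i` (the index set is finite, so the direct sum is the product). -/
noncomputable def partialSum {n : ℕ} (P : Fin n → FGModuleCat.{u} A) (T : Set (Fin n)) :
    FGModuleCat.{u} A :=
  FGModuleCat.of A (∀ i : T, P i)

/-- `B = End_A(X)ᵒᵖ`. The product `f * g` of `End X` is the composition `f ∘ g` of maps. -/
abbrev EndOp (X : FGModuleCat.{u} A) : Type u := (End X)ᵐᵒᵖ

theorem finite_hom (k : Type w) [Field k] [Algebra k A] [Module.Finite k A]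
    (X Y : FGModuleCat.{u} A) : Module.Finite (EndOp X) (X ⟶ Y) := by
  let _ : Module k X := Module.restrictScalars k A X
  let _ : Module k Y := Module.restrictScalars k A Y
  have : IsScalarTower k A X := IsScalarTower.restrictScalars k A X
  have : IsScalarTower k A Y := IsScalarTower.restrictScalars k A Y
  have : Module.Finite k X := Module.Finite.trans A X
  have : Module.Finite k Y := Module.Finite.trans A Y
  let φ : (X ⟶ Y) →ₗ[k] (X →ₗ[k] Y) :=
    { toFun := fun f => f.hom.hom.restrictScalars k
      map_add' := fun _ _ => rfl
      map_smul' := fun _ _ => rfl }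
  have hφ : Function.Injective φ := fun f g h => by
    ext x
    exact LinearMap.congr_fun h x
  have : Module.Finite k (X ⟶ Y) := Module.Finite.of_injective φ hφ
  have : IsScalarTower k (EndOp X) (X ⟶ Y) := ⟨fun c b f => by
    change (c • b.unop) ≫ f = c • (b.unop ≫ f)
    exact Linear.smul_comp _ _ _ _ _ _⟩
  exact Module.Finite.of_restrictScalars_finite k (EndOp X) (X ⟶ Y)

/-- The functor `Hom_A(X, -)` from `A`-mod to `End_A(X)ᵒᵖ`-mod, where `End_A(X)ᵒᵖ` acts on
`Hom_A(X, Y)` by precomposition. -/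
noncomputable def homFunctor (k : Type w) [Field k] [Algebra k A] [Module.Finite k A]
    (X : FGModuleCat.{u} A) : FGModuleCat.{u} A ⥤ FGModuleCat.{u} (EndOp X) :=
  (ModuleCat.isFG.{u} (EndOp X)).lift (preadditiveCoyonedaObj X) fun Y => finite_hom k X Y

end Presentations

end SerreQuot

namespace SerreQuot

/-! ### Splittings of `add(X)` and projectivity -/

section Retracts

variable {A : Type u} [Ring A]

/-! Write `X = P_{S'}`. Since `P_i` maps nontrivially to `M` exactly when `L_i` is a composition
factor of `M`, the Serre subcategory is the kernel of `Hom(X, -)`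
(`serreSubcategory_iff_hom_eq_zero`). As `X` is projective, `Hom(X, -)` is exact, so it inverts
precisely the morphisms being localized (`isoModSerre_iff_isIso_homFunctor_map`).

On modules presented by `X` this functor is an equivalence onto `B`-mod: it is bijective on maps
from such a module to any module (`homFunctor_map_bijective`), and every presentation over `B` comes
from one by powers of `X` (`exists_presentedBy_iso_homFunctor`).

Allowing arbitrary targets makes `Hom(X, -)`, followed by the inverse equivalence, right adjoint to
the inclusion. A right adjoint of a fully faithful functor is a localization at the morphisms it
inverts, so it is a model of the Serre quotient. -/

theorem addClosure.exists_sum_comp_eq_id {X Y : FGModuleCat.{u} A} (h : addClosure X Y) :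
    ∃ (m : ℕ) (s : Fin m → (Y ⟶ X)) (r : Fin m → (X ⟶ Y)), ∑ j, s j ≫ r j = 𝟙 Y := by
  obtain ⟨m, Z, hZ, ⟨e⟩⟩ := h
  choose W hW using hZ
  let d := fun j => (hW j).some
  refine ⟨m,
    fun j => FGModuleCat.ofHom
      ((d j).symm.toLinearMap ∘ₗ LinearMap.inl A (Z j) (W j) ∘ₗ LinearMap.proj j ∘ₗ e.toLinearMap),
    fun j => FGModuleCat.ofHom
      (e.symm.toLinearMap ∘ₗ LinearMap.single A _ j ∘ₗ LinearMap.fst A (Z j) (W j) ∘ₗ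
        (d j).toLinearMap), ?_⟩
  have key : ∀ y : Y, ∑ j, e.symm (Pi.single j (e y j)) = y := fun y => by
    rw [← map_sum, Finset.univ_sum_single, e.symm_apply_apply]
  have hsum : ∀ (m : ℕ) (f : Fin m → (Y ⟶ Y)) (y : Y),
      (∑ j, f j).hom.hom y = ∑ j, (f j).hom.hom y := fun m f y =>
    map_sum (AddMonoidHom.mk' (fun g : Y ⟶ Y => g.hom.hom y) fun _ _ => rfl) f Finset.univ
  ext y
  rw [hsum]
  refine (Finset.sum_congr rfl fun j _ => ?_).trans (key y)
  change e.symm (Pi.single j (d j ((d j).symm (e y j, 0))).1) = _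
  rw [LinearEquiv.apply_symm_apply]

theorem addClosure_pi (X : FGModuleCat.{u} A) (m : ℕ) :
    addClosure X (FGModuleCat.of A (Fin m → X)) :=
  ⟨m, fun _ => X, fun _ => ⟨FGModuleCat.of A PUnit, ⟨LinearEquiv.prodUnique.symm⟩⟩,
    ⟨LinearEquiv.refl A _⟩⟩

theorem projective_of_module_projective [IsArtinianRing A] (X : FGModuleCat.{u} A)
    [Module.Projective A X] : Projective X where
  factors f e _ := by
    obtain ⟨h, hh⟩ := Module.projective_lifting_property e.hom.hom f.hom.hom (surjective_of_epi e)
    exact ⟨FGModuleCat.ofHom h, by ext x; exact LinearMap.congr_fun hh x⟩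

end Retracts

/-! ### The Serre subcategory as the kernel of `Hom(X, -)` -/

section CompositionFactors

variable {A : Type u} [Ring A]

/-- The kernel of `π` is maximal and superfluous, so it contains the kernel of any nonzero `f`, and
`π` descends to the image of `f`. Conversely, `π` lifts along a surjection from a submodule of `M`
onto `L`. -/
theorem IsProjectiveCover.exists_ne_zero_iff [IsArtinianRing A] {P L M : FGModuleCat.{u} A}
    [IsSimpleModule A L] {π : P →ₗ[A] L} (hπ : IsProjectiveCover π) :
    (∃ f : P →ₗ[A] M, f ≠ 0) ↔ IsCompositionFactor (A := A) L M := by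
  have := hπ.projective
  rw [isCompositionFactor_iff]
  constructor
  · rintro ⟨f, hf⟩
    have hker : LinearMap.ker f ≤ LinearMap.ker π := by
      by_contra hle
      have hco : IsCoatom (LinearMap.ker π) := by
        rw [← isSimpleModule_iff_isCoatom]
        exact IsSimpleModule.congr (π.quotKerEquivOfSurjective hπ.surjective)
      refine hf (LinearMap.ker_eq_top.mp (hπ.superfluous _ ?_))
      exact hco.2 _ (lt_of_le_of_ne le_sup_right fun h => hle (by rw [h]; exact le_sup_left))
    refine ⟨inferInstance, LinearMap.range f,
      (LinearMap.ker f).liftQ π hker ∘ₗ f.quotKerEquivRange.symm.toLinearMap, ?_⟩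
    intro l
    obtain ⟨x, rfl⟩ := hπ.surjective l
    exact ⟨f.quotKerEquivRange (Submodule.Quotient.mk x), by simp⟩
  · rintro ⟨hL, U, g, hg⟩
    obtain ⟨h, hh⟩ := Module.projective_lifting_property g π hg
    refine ⟨U.subtype ∘ₗ h, fun h0 => ?_⟩
    have h1 : h = 0 := by
      ext x
      exact LinearMap.congr_fun h0 x
    have : Nontrivial L := IsSimpleModule.nontrivial A L
    obtain ⟨l, hl⟩ := exists_ne (0 : L)
    obtain ⟨x, rfl⟩ := hπ.surjective l
    rw [← hh, h1] at hl
    simp at hl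

theorem serreSubcategory_iff_hom_eq_zero [IsArtinianRing A] {n : ℕ}
    {L P : Fin n → FGModuleCat.{u} A}
    (hL : ∀ i, IsSimpleModule A (L i)) (π : ∀ i, P i →ₗ[A] L i)
    (hπ : ∀ i, IsProjectiveCover (π i)) (S : Set (Fin n)) (M : FGModuleCat.{u} A) :
    serreSubcategory L S M ↔ ∀ f : partialSum P Sᶜ ⟶ M, f = 0 := by
  classical
  let T : Set (Fin n) := Sᶜ
  constructor
  · intro hM f
    have h0 : ∀ i : T, f.hom.hom ∘ₗ LinearMap.single A (fun i : T => P i) i = 0 := by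
      intro i
      by_contra hne
      exact i.2 (hM i ((hπ i).exists_ne_zero_iff.mp ⟨_, hne⟩))
    have : f.hom.hom = (0 : (∀ i : T, P i) →ₗ[A] M) :=
      LinearMap.pi_ext' fun i => (h0 i).trans (LinearMap.zero_comp _).symm
    ext x
    exact LinearMap.congr_fun this x
  · intro hM i hi
    by_contra hiS
    obtain ⟨f, hf⟩ := (hπ i).exists_ne_zero_iff.mpr hi
    let j : T := ⟨i, hiS⟩
    have h0 := hM (FGModuleCat.ofHom (f ∘ₗ LinearMap.proj (φ := fun i : T => P i) j))
    refine hf (LinearMap.ext fun x => ?_)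
    have hx : f (Pi.single (M := fun i : T => P i) j x j) = 0 :=
      congrArg (fun g : partialSum P T ⟶ M => g.hom.hom (Pi.single j x)) h0
    rwa [Pi.single_eq_same] at hx

theorem projective_partialSum [IsArtinianRing A] {n : ℕ} (P : Fin n → FGModuleCat.{u} A)
    (hP : ∀ i, Module.Projective A (P i)) (T : Set (Fin n)) : Projective (partialSum P T) := by
  have : Module.Projective A (∀ i : T, P i) := by
    classical
    exact .of_equiv (DFinsupp.linearEquivFunOnFintype (R := A) (M := fun i : T => P i))
  have : Module.Projective A (partialSum P T) := this
  exact projective_of_module_projective _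

end CompositionFactors

/-! ### Full faithfulness of `Hom(X, -)` -/

section HomFunctor

variable (k : Type w) [Field k] {A : Type u} [Ring A] [Algebra k A] [Module.Finite k A]
  (X : FGModuleCat.{u} A)

instance homFunctor_additive : (homFunctor k X).Additive where
  map_add {Y Z f f'} := by
    ext g
    exact Preadditive.comp_add _ _ _ g f f'

instance homFunctor_linear : (homFunctor k X).Linear k where
  map_smul {Y Z} f c := by
    ext g
    change g ≫ (c • f) = algebraMap k (EndOp X) c • (g ≫ f)
    rw [Algebra.algebraMap_eq_smul_one]
    change g ≫ (c • f) = (c • 𝟙 X) ≫ (g ≫ f)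
    rw [Linear.smul_comp, Category.id_comp]
    exact Linear.comp_smul _ _ _ _ _ _

variable {X}

theorem homFunctor_hom_comp {Y Z : FGModuleCat.{u} A}
    (φ : (homFunctor k X).obj Y ⟶ (homFunctor k X).obj Z) (b : X ⟶ X) (g : X ⟶ Y) :
    φ.hom.hom (b ≫ g : X ⟶ Y) = (b ≫ (φ.hom.hom g : X ⟶ Z) : X ⟶ Z) :=
  φ.hom.hom.map_smul (MulOpposite.op b : EndOp X) g

theorem homFunctor_hom_sum {Y Z : FGModuleCat.{u} A}
    (φ : (homFunctor k X).obj Y ⟶ (homFunctor k X).obj Z) {m : ℕ} (g : Fin m → (X ⟶ Y)) :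
    φ.hom.hom (∑ j, g j : X ⟶ Y) = (∑ j, (φ.hom.hom (g j) : X ⟶ Z) : X ⟶ Z) :=
  map_sum φ.hom.hom g Finset.univ

theorem homFunctor_map_eq_iff {Y Z : FGModuleCat.{u} A} (f : Y ⟶ Z)
    (φ : (homFunctor k X).obj Y ⟶ (homFunctor k X).obj Z) :
    (homFunctor k X).map f = φ ↔ ∀ g : X ⟶ Y, g ≫ f = φ.hom.hom g := by
  constructor
  · rintro rfl g
    rfl
  · intro h
    ext g
    exact h g

/-- Since `𝟙 Y = ∑ s j ≫ r j` factors through copies of `X`, a map out of `Y` is determined by its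
composites with the `r j`, and `∑ s j ≫ φ (r j)` realizes `φ`. -/
theorem homFunctor_map_bijective_of_addClosure {Y : FGModuleCat.{u} A} (hY : addClosure X Y)
    (Z : FGModuleCat.{u} A) :
    Function.Bijective ((homFunctor k X).map : (Y ⟶ Z) → _) := by
  obtain ⟨m, s, r, hsr⟩ := hY.exists_sum_comp_eq_id
  constructor
  · intro f g hfg
    have h : ∀ a : X ⟶ Y, a ≫ f = a ≫ g := (homFunctor_map_eq_iff k f _).mp hfg
    rw [← Category.id_comp f, ← Category.id_comp g, ← hsr]
    simp only [Preadditive.sum_comp, Category.assoc, h]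
  · intro φ
    refine ⟨∑ j, s j ≫ (φ.hom.hom (r j) : X ⟶ Z), (homFunctor_map_eq_iff k _ φ).mpr fun g => ?_⟩
    conv_rhs => rw [← Category.comp_id g, ← hsr, Preadditive.comp_sum, homFunctor_hom_sum]
    rw [Preadditive.comp_sum]
    refine Finset.sum_congr rfl fun j _ => ?_
    exact (Category.assoc _ _ _).symm.trans ((homFunctor_hom_comp k φ _ _).symm.trans
      (congrArg φ.hom.hom (Category.assoc _ _ _)))

variable [Projective X]

theorem homFunctor_map_bijective {Y : FGModuleCat.{u} A} (hY : presentedBy X Y)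
    (Z : FGModuleCat.{u} A) :
    Function.Bijective ((homFunctor k X).map : (Y ⟶ Z) → _) := by
  obtain ⟨X₁, X₀, f, g, h₁, h₀, hfg, hg⟩ := hY
  let f' : X₁ ⟶ X₀ := FGModuleCat.ofHom f
  let g' : X₀ ⟶ Y := FGModuleCat.ofHom g
  have : Epi g' := ConcreteCategory.epi_of_surjective g' hg
  have b₁ := homFunctor_map_bijective_of_addClosure k h₁ Z
  have b₀ := homFunctor_map_bijective_of_addClosure k h₀ Z
  have hfg' : f' ≫ g' = 0 := by
    ext x
    exact hfg.apply_apply_eq_zero x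
  constructor
  · intro a b hab
    rw [← cancel_epi g']
    apply b₀.1
    rw [Functor.map_comp, Functor.map_comp, hab]
  · intro φ
    -- Realize `φ` on `X₀`; faithfulness on `X₁` makes the result vanish on relations, hence descend
    -- to `Y`.
    obtain ⟨a, ha⟩ := b₀.2 ((homFunctor k X).map g' ≫ φ)
    have hfa : f' ≫ a = 0 := by
      apply b₁.1
      rw [Functor.map_comp, ha, ← Functor.map_comp_assoc, hfg', Functor.map_zero,
        Functor.map_zero, Limits.zero_comp]
    have hker : LinearMap.ker g ≤ LinearMap.ker a.hom.hom := by
      intro x hx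
      obtain ⟨y, rfl⟩ := (hfg x).mp hx
      exact congrArg (fun t : X₁ ⟶ Z => t.hom.hom y) hfa
    let d : Y ⟶ Z := FGModuleCat.ofHom
      ((LinearMap.ker g).liftQ a.hom.hom hker ∘ₗ
        (g.quotKerEquivOfSurjective hg).symm.toLinearMap)
    have hd : g' ≫ d = a := by
      ext x
      change (LinearMap.ker g).liftQ a.hom.hom hker
        ((g.quotKerEquivOfSurjective hg).symm (g x)) = a.hom.hom x
      have : (g.quotKerEquivOfSurjective hg).symm (g x) = Submodule.Quotient.mk x := by
        rw [LinearEquiv.symm_apply_eq]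
        rfl
      rw [this, Submodule.liftQ_apply]
    refine ⟨d, (homFunctor_map_eq_iff k _ φ).mpr fun h => ?_⟩
    -- Projectivity of `X` lifts `h` to `X₀`, where `φ` is already known.
    have hh := (homFunctor_map_eq_iff k _ _).mp ha (Projective.factorThru h g')
    rw [← hd, Projective.factorThru_comp_assoc] at hh
    rw [hh]
    change φ.hom.hom (Projective.factorThru h g' ≫ g' : X ⟶ Y) = _
    rw [Projective.factorThru_comp]

end HomFunctor

/-! ### Essential surjectivity onto `B`-mod -/

section EssSurj

/-- The `j`-th coordinate `X^m ⟶ X`. -/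
def powProj {A : Type u} [Ring A] (X : FGModuleCat.{u} A) {m : ℕ} (j : Fin m) :
    FGModuleCat.of A (Fin m → X) ⟶ X :=
  FGModuleCat.ofHom (LinearMap.proj j)

/-- The `j`-th inclusion `X ⟶ X^m`. -/
def powSingle {A : Type u} [Ring A] (X : FGModuleCat.{u} A) {m : ℕ} (j : Fin m) :
    X ⟶ FGModuleCat.of A (Fin m → X) :=
  FGModuleCat.ofHom (LinearMap.single A (fun _ => X) j)

theorem powSingle_comp_powProj_self {A : Type u} [Ring A] (X : FGModuleCat.{u} A) {m : ℕ}
    (j : Fin m) : powSingle X j ≫ powProj X j = 𝟙 X :=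
  ObjectProperty.hom_ext _ <| ModuleCat.hom_ext <| LinearMap.ext fun x =>
    Pi.single_eq_same (M := fun _ : Fin m => X) j x

theorem powSingle_comp_powProj_of_ne {A : Type u} [Ring A] (X : FGModuleCat.{u} A) {m : ℕ}
    {i j : Fin m} (h : i ≠ j) : powSingle X j ≫ powProj X i = 0 := by
  ext x
  exact Pi.single_eq_of_ne (M := fun _ : Fin m => X) h x

theorem isNoetherianRing_endOp (k : Type w) [Field k] {A : Type u} [Ring A] [Algebra k A]
    [Module.Finite k A] (X : FGModuleCat.{u} A) : IsNoetherianRing (EndOp X) := by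
  let _ : Module k X := Module.restrictScalars k A X
  have : IsScalarTower k A X := IsScalarTower.restrictScalars k A X
  have : Module.Finite k X := Module.Finite.trans A X
  let φ : EndOp X →ₗ[k] (X →ₗ[k] X) :=
    { toFun := fun f => f.unop.hom.hom.restrictScalars k
      map_add' := fun _ _ => rfl
      map_smul' := fun _ _ => rfl }
  have hφ : Function.Injective φ := fun f g h =>
    MulOpposite.unop_injective <| ObjectProperty.hom_ext _ <| ModuleCat.hom_ext <|
      LinearMap.ext fun x => LinearMap.congr_fun h x
  have : Module.Finite k (EndOp X) := Module.Finite.of_injective φ hφ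
  exact IsNoetherianRing.of_finite k (EndOp X)

theorem exists_presentedBy_iso_homFunctor (k : Type w) [Field k] {A : Type u} [Ring A]
    [Algebra k A] [Module.Finite k A] [IsArtinianRing A] (X : FGModuleCat.{u} A) [Projective X]
    (N : FGModuleCat.{u} (EndOp X)) :
    ∃ Y, presentedBy X Y ∧ Nonempty ((homFunctor k X).obj Y ≅ N) := by
  classical
  have := isNoetherianRing_endOp k X
  obtain ⟨b, v, hv⟩ := Module.Finite.exists_fin (R := EndOp X) (M := N)
  let X₀ : FGModuleCat.{u} A := FGModuleCat.of A (Fin b → X)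
  -- Under `Hom(X, X^b) ≅ B^b`, this sends the `j`-th basis vector to the generator `v j`.
  let p : (X ⟶ X₀) →ₗ[EndOp X] N :=
    { toFun := fun h => ∑ j, (MulOpposite.op (h ≫ powProj X j) : EndOp X) • v j
      map_add' := fun h h' => by
        simp only [Preadditive.add_comp, MulOpposite.op_add, add_smul, Finset.sum_add_distrib]
      map_smul' := fun c h => by
        rw [Finset.smul_sum]
        refine Finset.sum_congr rfl fun j _ => ?_
        rw [RingHom.id_apply, smul_smul]
        rfl }
  have hp : Function.Surjective p := by
    rw [← LinearMap.range_eq_top, eq_top_iff, ← hv, Submodule.span_le]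
    rintro _ ⟨j, rfl⟩
    refine ⟨powSingle X j, ?_⟩
    change ∑ i, (MulOpposite.op (powSingle X j ≫ powProj X i) : EndOp X) • v i = v j
    rw [Finset.sum_eq_single j]
    · rw [powSingle_comp_powProj_self]
      exact one_smul _ _
    · intro i _ hij
      rw [powSingle_comp_powProj_of_ne X hij, MulOpposite.op_zero, zero_smul]
    · simp
  have := finite_hom k X X₀
  obtain ⟨a, w, hw⟩ := Submodule.fg_iff_exists_fin_generating_family.mp
    (IsNoetherian.noetherian (LinearMap.ker p))
  let X₁ : FGModuleCat.{u} A := FGModuleCat.of A (Fin a → X)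
  -- The `i`-th copy of `X` maps by the relation `w i`, so `Hom(X, f₁)` has image `ker p`.
  let f₁ : X₁ ⟶ X₀ := ∑ i, powProj X i ≫ w i
  let f : (Fin a → X) →ₗ[A] (Fin b → X) := f₁.hom.hom
  have hf₁ : ∀ i, w i = powSingle X i ≫ f₁ := fun i => by
    rw [Preadditive.comp_sum, Finset.sum_eq_single i]
    · rw [← Category.assoc, powSingle_comp_powProj_self, Category.id_comp]
    · intro j _ hij
      rw [← Category.assoc, powSingle_comp_powProj_of_ne X hij, Limits.zero_comp]
    · simp
  let Y : FGModuleCat.{u} A := FGModuleCat.of A ((Fin b → X) ⧸ LinearMap.range f)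
  let g : X₀ ⟶ Y := FGModuleCat.ofHom (LinearMap.range f).mkQ
  have hg : Function.Surjective g.hom.hom := Submodule.mkQ_surjective _
  have : Epi g := ConcreteCategory.epi_of_surjective g hg
  let q : (X ⟶ X₀) →ₗ[EndOp X] (X ⟶ Y) := ((homFunctor k X).map g).hom.hom
  have hq : Function.Surjective q := fun h =>
    ⟨Projective.factorThru h g, Projective.factorThru_comp h g⟩
  have := finite_hom k X Y
  -- If `h ≫ g = 0`, then `h` lands in the range of `f` and lifts to `X₁` by projectivity; the
  -- coordinates of the lift are the coefficients of `h` in the `w i`.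
  have hker : LinearMap.ker q = LinearMap.ker p := by
    apply le_antisymm
    · intro h hh
      have hh' : h ≫ g = 0 := hh
      let f' : X₁ ⟶ FGModuleCat.of A (LinearMap.range f) :=
        FGModuleCat.ofHom f.rangeRestrict
      have : Epi f' := ConcreteCategory.epi_of_surjective f' f.surjective_rangeRestrict
      let h' : X ⟶ FGModuleCat.of A (LinearMap.range f) := FGModuleCat.ofHom
        (h.hom.hom.codRestrict (LinearMap.range f) fun x => by
          have := congrArg (fun t : X ⟶ Y => t.hom.hom x) hh'
          exact (Submodule.Quotient.mk_eq_zero _).mp this)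
      let t := Projective.factorThru h' f'
      have ht : t ≫ f' = h' := Projective.factorThru_comp _ _
      have htf : t ≫ f₁ = h := by
        refine ObjectProperty.hom_ext _ <| ModuleCat.hom_ext <| LinearMap.ext fun x => ?_
        exact congrArg (fun t : X ⟶ FGModuleCat.of A (LinearMap.range f) =>
          (t.hom.hom x : LinearMap.range f).1) ht
      have hsum : h = ∑ i, (MulOpposite.op (t ≫ powProj X i) : EndOp X) • w i := by
        rw [← htf, Preadditive.comp_sum]
        exact Finset.sum_congr rfl fun i _ => (Category.assoc _ _ _).symm
      rw [hsum, ← hw]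
      exact Submodule.sum_mem _ fun i _ =>
        Submodule.smul_mem _ _ (Submodule.subset_span ⟨i, rfl⟩)
    · rw [← hw, Submodule.span_le]
      rintro _ ⟨i, rfl⟩
      change w i ≫ g = 0
      ext x
      refine (Submodule.Quotient.mk_eq_zero _).mpr ⟨Pi.single i x, ?_⟩
      rw [hf₁]
      rfl
  refine ⟨Y, ⟨X₁, X₀, f, g.hom.hom, addClosure_pi X a, addClosure_pi X b,
    fun y => ?_, hg⟩, ⟨?_⟩⟩
  · exact Submodule.Quotient.mk_eq_zero _
  · exact LinearEquiv.toFGModuleCatIso ((q.quotKerEquivOfSurjective hq).symm.trans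
      ((Submodule.quotEquivOfEq _ _ hker).trans (p.quotKerEquivOfSurjective hp)))

end EssSurj

/-! ### Morphisms inverted by `Hom(X, -)` -/

section Localization

variable (k : Type w) [Field k] {A : Type u} [Ring A] [Algebra k A] [Module.Finite k A]

theorem isIso_of_bijective {R : Type u} [Ring R] {M N : FGModuleCat.{u} R} (f : M ⟶ N)
    (hf : Function.Bijective f.hom.hom) : IsIso f :=
  (LinearEquiv.toFGModuleCatIso (LinearEquiv.ofBijective f.hom.hom hf)).isIso_hom

theorem bijective_of_isIso {R : Type u} [Ring R] {M N : FGModuleCat.{u} R} (f : M ⟶ N)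
    [IsIso f] : Function.Bijective f.hom.hom :=
  (FGModuleCat.isoToLinearEquiv (asIso f)).bijective

theorem isIso_homFunctor_map_iff {X Y Z : FGModuleCat.{u} A} (f : Y ⟶ Z) :
    IsIso ((homFunctor k X).map f) ↔ Function.Bijective fun h : X ⟶ Y => h ≫ f :=
  ⟨fun _ => bijective_of_isIso ((homFunctor k X).map f), fun h => isIso_of_bijective _ h⟩

/-- By exactness of `Hom(X, -)`, its vanishing on the kernel and on the cokernel of `f` means
injectivity and surjectivity of composition with `f`. -/
theorem isoModSerre_iff_isIso_homFunctor_map [IsArtinianRing A] (X : FGModuleCat.{u} A)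
    [Projective X] (Q : ObjectProperty (FGModuleCat.{u} A)) [Q.IsSerreClass]
    (hQ : ∀ M, Q M ↔ ∀ f : X ⟶ M, f = 0) {Y Z : FGModuleCat.{u} A} (f : Y ⟶ Z) :
    Q.isoModSerre f ↔ IsIso ((homFunctor k X).map f) := by
  rw [isIso_homFunctor_map_iff]
  change (Q (Limits.kernel f) ∧ Q (Limits.cokernel f)) ↔ _
  rw [hQ, hQ]
  constructor
  · rintro ⟨h₁, h₂⟩
    constructor
    · intro a b hab
      have : (a - b) ≫ f = 0 := by
        rw [Preadditive.sub_comp, sub_eq_zero]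
        exact hab
      rw [← sub_eq_zero, ← Limits.kernel.lift_ι f _ this, h₁ (Limits.kernel.lift f _ this),
        Limits.zero_comp]
    · intro h
      have hE : (ShortComplex.mk f (Limits.cokernel.π f) (Limits.cokernel.condition f)).Exact :=
        ShortComplex.exact_cokernel f
      exact ⟨hE.liftFromProjective h (h₂ _), hE.liftFromProjective_comp h (h₂ _)⟩
  · rintro ⟨h₁, h₂⟩
    constructor
    · intro a
      rw [← cancel_mono (Limits.kernel.ι f), Limits.zero_comp]
      apply h₁
      simp
    · intro a
      obtain ⟨b, hb⟩ := h₂ (Projective.factorThru a (Limits.cokernel.π f))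
      rw [← Projective.factorThru_comp a (Limits.cokernel.π f), ← hb]
      simp

end Localization

/-! ### The coreflection as a model of the Serre quotient -/

section Equivalences

variable (k : Type w) [Field k] {A : Type u} [Ring A] [Algebra k A] [Module.Finite k A]
  [IsArtinianRing A] (X : FGModuleCat.{u} A) [Projective X]

theorem isEquivalence_presentedBy_homFunctor :
    ((presentedBy X).ι ⋙ homFunctor k X).IsEquivalence where
  faithful := ⟨fun {Y Z f g} h => by
    ext : 1
    exact (homFunctor_map_bijective k Y.property Z.obj).1 h⟩
  full := ⟨fun {Y Z} φ => by
    obtain ⟨f, hf⟩ := (homFunctor_map_bijective k Y.property Z.obj).2 φ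
    exact ⟨(presentedBy X).homMk f, hf⟩⟩
  essSurj := ⟨fun N => by
    obtain ⟨Y, hY, ⟨e⟩⟩ := exists_presentedBy_iso_homFunctor k X N
    exact ⟨⟨Y, hY⟩, ⟨e⟩⟩⟩

/-- The equivalence `Hom_A(X, -)` from the modules presented by `X` to `End_A(X)ᵒᵖ`-mod. -/
noncomputable def homEquivalence :
    (presentedBy X).FullSubcategory ≌ FGModuleCat.{u} (EndOp X) :=
  have := isEquivalence_presentedBy_homFunctor k X
  ((presentedBy X).ι ⋙ homFunctor k X).asEquivalence

/-- The coreflection of `A`-mod onto the modules presented by `X`. -/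
noncomputable abbrev coreflection : FGModuleCat.{u} A ⥤ (presentedBy X).FullSubcategory :=
  homFunctor k X ⋙ (homEquivalence k X).inverse

instance homEquivalence_functor_linear : (homEquivalence k X).functor.Linear k :=
  inferInstanceAs (((presentedBy X).ι ⋙ homFunctor k X).Linear k)

/-- The bijection `Hom_A(Y, M) ≃ Hom_B(Hom_A(X, Y), Hom_A(X, M))` for `Y` presented by `X`. -/
noncomputable def homFunctorMapEquiv (Y : (presentedBy X).FullSubcategory) (M : FGModuleCat.{u} A) :
    ((presentedBy X).ι.obj Y ⟶ M) ≃
      ((homEquivalence k X).functor.obj Y ⟶ (homFunctor k X).obj M) :=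
  Equiv.ofBijective _ (homFunctor_map_bijective k Y.property M)

theorem homFunctorMapEquiv_naturality_left {Y' Y : (presentedBy X).FullSubcategory}
    {M : FGModuleCat.{u} A} (f : Y' ⟶ Y) (g : (presentedBy X).ι.obj Y ⟶ M) :
    homFunctorMapEquiv k X Y' M ((presentedBy X).ι.map f ≫ g) =
      (homEquivalence k X).functor.map f ≫ homFunctorMapEquiv k X Y M g :=
  (homFunctor k X).map_comp _ _

theorem homFunctorMapEquiv_naturality_right {Y : (presentedBy X).FullSubcategory}
    {M M' : FGModuleCat.{u} A} (f : (presentedBy X).ι.obj Y ⟶ M) (g : M ⟶ M') :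
    homFunctorMapEquiv k X Y M' (f ≫ g) =
      homFunctorMapEquiv k X Y M f ≫ (homFunctor k X).map g :=
  (homFunctor k X).map_comp _ _

/-- The inclusion of the modules presented by `X` is left adjoint to the coreflection. -/
noncomputable def inclusionAdjunction : (presentedBy X).ι ⊣ coreflection k X :=
  Adjunction.mkOfHomEquiv
    { homEquiv := fun Y M => (homFunctorMapEquiv k X Y M).trans
        ((homEquivalence k X).toAdjunction.homEquiv Y ((homFunctor k X).obj M))
      homEquiv_naturality_left_symm := fun {Y' Y M} f g => by
        rw [Equiv.symm_apply_eq, Equiv.trans_apply, homFunctorMapEquiv_naturality_left,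
          Equiv.symm_trans_apply, Equiv.apply_symm_apply]
        refine Eq.trans ?_ ((homEquivalence k X).toAdjunction.homEquiv_naturality_left f _).symm
        rw [Equiv.apply_symm_apply]
      homEquiv_naturality_right := fun {Y M M'} f g => by
        rw [Equiv.trans_apply, homFunctorMapEquiv_naturality_right]
        exact (homEquivalence k X).toAdjunction.homEquiv_naturality_right _ _ }

variable {k X}

theorem isLocalization_coreflection (Q : ObjectProperty (FGModuleCat.{u} A)) [Q.IsSerreClass]
    (hQ : ∀ M, Q M ↔ ∀ f : X ⟶ M, f = 0) : (coreflection k X).IsLocalization Q.isoModSerre := by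
  have h : Q.isoModSerre = (MorphismProperty.isomorphisms _).inverseImage (coreflection k X) := by
    ext Y Z f
    rw [isoModSerre_iff_isIso_homFunctor_map k X Q hQ]
    exact (isIso_iff_of_reflects_iso _ (homEquivalence k X).inverse).symm
  rw [h]
  exact (inclusionAdjunction k X).isLocalization_rightAdjoint'

variable (k X)

theorem exists_equivalence_of_isSerreClass (Q : ObjectProperty (FGModuleCat.{u} A))
    [Q.IsSerreClass] (hQ : ∀ M, Q M ↔ ∀ f : X ⟶ M, f = 0) :
    ∃ E : Q.isoModSerre.Localization ≌ (presentedBy X).FullSubcategory,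
      E.functor.Linear k ∧ Nonempty (E.inverse ≅ (presentedBy X).ι ⋙ Q.isoModSerre.Q) := by
  have := isLocalization_coreflection (k := k) Q hQ
  let E := Localization.equivalenceFromModel (coreflection k X) Q.isoModSerre
  let e : Q.isoModSerre.Q ⋙ E.functor ≅ coreflection k X :=
    Localization.qCompEquivalenceFromModelFunctorIso _ _
  have : Localization.Lifting Q.isoModSerre.Q Q.isoModSerre (coreflection k X) E.functor := ⟨e⟩
  -- Linearity is tested after composing with the quotient functor, where `E.functor` becomes the
  -- coreflection.
  refine ⟨E, (Localization.functor_linear_iff Q.isoModSerre.Q Q.isoModSerre k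
    (coreflection k X) E.functor).mp inferInstance, ⟨?_⟩⟩
  -- The unit is invertible because the inclusion is fully faithful. Insert it before `E.inverse`,
  -- replace the coreflection by the quotient functor followed by `E.functor`, and cancel `E`.
  exact (Functor.leftUnitor _).symm ≪≫
    Functor.isoWhiskerRight (asIso (inclusionAdjunction k X).unit) E.inverse ≪≫
    Functor.associator _ _ _ ≪≫
    Functor.isoWhiskerLeft (presentedBy X).ι
      (Functor.isoWhiskerRight e.symm E.inverse ≪≫ Functor.associator _ _ _ ≪≫
        Functor.isoWhiskerLeft _ E.unitIso.symm ≪≫ Functor.rightUnitor _)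

end Equivalences

end SerreQuot

theorem mainTheorem9 (k : Type w) [Field k] [IsAlgClosed k]
    (A : Type u) [Ring A] [Algebra k A] [Module.Finite k A]
    (hA : SerreQuot.IsBasicAlgebra k A)
    {n : ℕ} (L P : Fin n → FGModuleCat.{u} A)
    (hL_simple : ∀ i, IsSimpleModule A (L i))
    (hL_noniso : ∀ i j, Nonempty (L i ≃ₗ[A] L j) → i = j)
    (hL_complete : ∀ M : FGModuleCat.{u} A, IsSimpleModule A M → ∃ i, Nonempty (M ≃ₗ[A] L i))
    (π : ∀ i, P i →ₗ[A] L i) (hπ : ∀ i, SerreQuot.IsProjectiveCover (π i))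
    (S : Set (Fin n)) (hS : S ≠ Set.univ) :
    haveI : IsArtinianRing A := IsArtinianRing.of_finite k A
    ∃ (E : SerreQuot.SerreQuotient L S ≌
          (SerreQuot.presentedBy (SerreQuot.partialSum P Sᶜ)).FullSubcategory)
      (F : (SerreQuot.presentedBy (SerreQuot.partialSum P Sᶜ)).FullSubcategory ≌
          FGModuleCat.{u} (SerreQuot.EndOp (SerreQuot.partialSum P Sᶜ))),
      E.functor.Linear k ∧ F.functor.Linear k ∧
      Nonempty (E.inverse ≅
        (SerreQuot.presentedBy (SerreQuot.partialSum P Sᶜ)).ι ⋙ SerreQuot.quotientFunctor L S) ∧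
      Nonempty (F.functor ≅
        (SerreQuot.presentedBy (SerreQuot.partialSum P Sᶜ)).ι ⋙
          SerreQuot.homFunctor k (SerreQuot.partialSum P Sᶜ)) := by
  have : IsArtinianRing A := IsArtinianRing.of_finite k A
  have : Projective (SerreQuot.partialSum P Sᶜ) :=
    SerreQuot.projective_partialSum P (fun i => (hπ i).projective) Sᶜ
  obtain ⟨E, hE, hE'⟩ := SerreQuot.exists_equivalence_of_isSerreClass k
    (SerreQuot.partialSum P Sᶜ) (SerreQuot.serreSubcategory L S)
    (SerreQuot.serreSubcategory_iff_hom_eq_zero hL_simple π hπ S)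
  exact ⟨E, SerreQuot.homEquivalence k (SerreQuot.partialSum P Sᶜ), hE, inferInstance, hE',
    ⟨Iso.refl _⟩⟩
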